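/- Let $X\subset\mathbb R^d$ be nonempty, convex and compact. In online convex optimization over $X$ with losses $f_1,\dots,f_T$, a learner that plays $x_1,\dots,x_T\in X$ has regret $R_T=\sum_{t=1}^T f_t(x_t)-\min_{x\in X}\sum_{t=1}^T f_t(x)$. The Online Newton Step (ONS) with parameters $\gamma,\varepsilon>0$ and starting point $x_1\in X$ sets $A_0=\varepsilon I_d$ and, for $t\ge 1$, with $g_t=\nabla f_t(x_t)$, $$A_t=A_{t-1}+g_tg_t^\top,\qquad y_{t+1}=x_t-\gamma^{-1}A_t^{-1}g_t,\qquad x_{t+1}=\operatorname*{arg\,min}_{x\in X}\,(y_{t+1}-x)^\top A_t\,(y_{t+1}-x).$$ A function $f$ is $\alpha$-exp-concave on $X$ if $\exp(-\alpha f)$ is concave on $X$. A sequence $(f_1,\dots,f_T)$ of convex functions is $k$-contaminated $\alpha$-exp-concave if there is $I\subset\{1,\dots,T\}$ with $|I|=k$ such that $f_t$ is $\alpha$-exp-concave for every $t\in\{1,\dots,T\}\setminus I$. **Corollary.** For all parameters $\gamma,\varepsilon>0$, the worst-case regret of ONS on $k$-contaminated $\alpha$-exp-concave losses is $\Omega((d/\alpha)\log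 T+k)$. Precisely: there is an absolute constant $c_1>0$, and for all $G,D,\gamma>0$ there is a constant $c_2>0$ depending only on $G,D,\gamma$, such that for every dimension $d\ge1$ and all $\alpha,\varepsilon>0$ there are a nonempty compact convex set $X\subset\mathbb R^d$ of diameter at most $D$ and a $T_0\in\mathbb N$ with the following property. For all integers $T\ge T_0$ and $0\le k\le T$ and every starting point $x_1\in X$ there is a $k$-contaminated $\alpha$-exp-concave sequence $f_1,\dots,f_T$ of functions that are convex on $X$ and differentiable at the points of $X$, with $\|\nabla f_t(x)\|\le G$ for all $x\in X$ and all $t$, on which ONS with parameters $\gamma,\varepsilon$ and starting point $x_1$ has regret $$R_T\ \ge\ c_1\,\frac d\alpha\,\log T+c_2\,k .$$ -/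

import Mathlib

namespace ContaminatedOCO

/-- `f` is `α`-exp-concave on `X`: the function `exp (-α f)` is concave on `X`. -/
def IsExpConcave {d : ℕ} (X : Set (EuclideanSpace ℝ (Fin d))) (α : ℝ)
    (f : EuclideanSpace ℝ (Fin d) → ℝ) : Prop :=
  ConcaveOn ℝ X (fun x => Real.exp (-(α * f x)))

/-- The losses of rounds `0, …, T - 1` are `k`-contaminated `F`: outside an index set of exactly
`k` rounds every loss belongs to the function class `F`. -/
def IsContaminated {d : ℕ} (F : Set (EuclideanSpace ℝ (Fin d) → ℝ)) (T k : ℕ)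
    (f : ℕ → EuclideanSpace ℝ (Fin d) → ℝ) : Prop :=
  ∃ I : Finset ℕ, I ⊆ Finset.range T ∧ I.card = k ∧ ∀ t ∈ Finset.range T \ I, f t ∈ F

/-- Standing assumptions on the decision set: nonempty, convex, compact, of diameter at most `D`. -/
structure IsDecisionSet {d : ℕ} (D : ℝ) (X : Set (EuclideanSpace ℝ (Fin d))) : Prop where
  nonempty : X.Nonempty
  convex : Convex ℝ X
  isCompact : IsCompact X
  dist_le : ∀ x ∈ X, ∀ y ∈ X, ‖x - y‖ ≤ D

/-- Standing assumptions on the losses of rounds `0, …, T - 1`: convex on `X`, differentiable at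
the points of `X`, with gradients of norm at most `G` there. -/
structure IsLossSequence {d : ℕ} (G : ℝ) (X : Set (EuclideanSpace ℝ (Fin d))) (T : ℕ)
    (f : ℕ → EuclideanSpace ℝ (Fin d) → ℝ) : Prop where
  convexOn : ∀ t < T, ConvexOn ℝ X (f t)
  differentiableAt : ∀ t < T, ∀ x ∈ X, DifferentiableAt ℝ (f t) x
  norm_gradient_le : ∀ t < T, ∀ x ∈ X, ‖gradient (f t) x‖ ≤ G

/-- The squared norm `‖v‖_A² = vᵀ A v`. -/
def sqNorm {d : ℕ} (A : Matrix (Fin d) (Fin d) ℝ) (v : EuclideanSpace ℝ (Fin d)) : ℝ :=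
  v.ofLp ⬝ᵥ (A.mulVec v.ofLp)

/-- The generalized projection `Π_X^A (y)`, a minimizer of `‖y - x‖_A²` over `x ∈ X`. -/
noncomputable def genProj {d : ℕ} (X : Set (EuclideanSpace ℝ (Fin d)))
    (A : Matrix (Fin d) (Fin d) ℝ) (y : EuclideanSpace ℝ (Fin d)) : EuclideanSpace ℝ (Fin d) :=
  Classical.epsilon fun x => x ∈ X ∧ ∀ z ∈ X, sqNorm A (y - x) ≤ sqNorm A (y - z)

/-- On a nonempty compact set the generalized projection is a genuine minimizer. -/
theorem genProj_spec {d : ℕ} {X : Set (EuclideanSpace ℝ (Fin d))} (hne : X.Nonempty)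
    (hX : IsCompact X) (A : Matrix (Fin d) (Fin d) ℝ) (y : EuclideanSpace ℝ (Fin d)) :
    genProj X A y ∈ X ∧ ∀ z ∈ X, sqNorm A (y - genProj X A y) ≤ sqNorm A (y - z) := by
  have hc : Continuous fun x : EuclideanSpace ℝ (Fin d) => sqNorm A (y - x) := by
    unfold sqNorm
    fun_prop
  obtain ⟨x, hx, hmin⟩ := hX.exists_isMinOn hne hc.continuousOn
  exact Classical.epsilon_spec
    (p := fun x => x ∈ X ∧ ∀ z ∈ X, sqNorm A (y - x) ≤ sqNorm A (y - z))
    ⟨x, hx, fun z hz => hmin hz⟩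

/-- The state of the Online Newton Step at the beginning of round `t` (rounds are numbered
`0, 1, 2, …`): the point played in round `t`, and the matrix accumulated in the earlier rounds.
It starts from `(x₁, ε I)`. With `g` the gradient of the current loss at the point `x` just played,
the matrix becomes `A' = A + g gᵀ` and the next point is `Π_X^{A'} (x - γ⁻¹ A'⁻¹ g)`. -/
noncomputable def onsState {d : ℕ} (X : Set (EuclideanSpace ℝ (Fin d))) (γ ε : ℝ)
    (x₁ : EuclideanSpace ℝ (Fin d)) (f : ℕ → EuclideanSpace ℝ (Fin d) → ℝ) :
    ℕ → EuclideanSpace ℝ (Fin d) × Matrix (Fin d) (Fin d) ℝ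
  | 0 => (x₁, ε • (1 : Matrix (Fin d) (Fin d) ℝ))
  | t + 1 =>
    let x := (onsState X γ ε x₁ f t).1
    let g := gradient (f t) x
    let A' := (onsState X γ ε x₁ f t).2 + Matrix.vecMulVec g.ofLp g.ofLp
    (genProj X A' (x - γ⁻¹ • WithLp.toLp 2 (A'⁻¹.mulVec g.ofLp)), A')

/-- The point played by the Online Newton Step in round `t`. -/
noncomputable def ons {d : ℕ} (X : Set (EuclideanSpace ℝ (Fin d))) (γ ε : ℝ)
    (x₁ : EuclideanSpace ℝ (Fin d)) (f : ℕ → EuclideanSpace ℝ (Fin d) → ℝ) (t : ℕ) :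
    EuclideanSpace ℝ (Fin d) :=
  (onsState X γ ε x₁ f t).1

/-- The regret after `T` rounds of the played points `x` on the losses `f`. The infimum is a minimum
when `X` is nonempty and compact and the losses are continuous on `X`. -/
noncomputable def regret {d : ℕ} (X : Set (EuclideanSpace ℝ (Fin d))) (T : ℕ)
    (f : ℕ → EuclideanSpace ℝ (Fin d) → ℝ) (x : ℕ → EuclideanSpace ℝ (Fin d)) : ℝ :=
  ∑ t ∈ Finset.range T, f t (x t) - sInf ((fun u => ∑ t ∈ Finset.range T, f t u) '' X)

end ContaminatedOCO

namespace ContaminatedOCO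

/-! A maximum of two numbers is at least half their sum, so it suffices to force either twice `c₁
(d/α) log T` or twice `c₂ k`, whichever target is larger. Both adversaries play on a box, where
coordinates decouple.

Logarithmic term (`block_regret`, `exists_log_regret`): an adaptive adversary treats the coordinates
in turn with losses `l/2 (x i - z)²`, `z = θ ± b`, where `θ` is the mean of the earlier centres,
with a prior of weight `s` at `0`. Random signs would give every learner expected regret of order `l
b² ∑ 1/(s+n+1)` against the final mean. The signs are instead chosen greedily for a potential
containing `κ (θ² - b² ∑ 1/(s+n+1)²)`, a martingale under fair signs. If `θ` leaves `(-ρ, ρ)`, the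
term `κ θ²` already pays for the bound and the adversary stops; hence the comparator stays in the
box. As `l b²` is of order `1/α`, each coordinate contributes order `(log T)/α`.

Linear term (`linear_regret`): about `k/2` linear losses with slopes `±G` inflate one diagonal entry
of the matrix at no gain to the learner. The Newton steps are then so short that during about `k/2`
further rounds of constant slope the learner cannot get near the good end of the box. -/

/-! ### Adaptive adversaries and regret. -/

/-- One round of the Online Newton Step on the loss `l`. -/
noncomputable def onsStep {d : ℕ} (X : Set (EuclideanSpace ℝ (Fin d))) (γ : ℝ)
    (p : EuclideanSpace ℝ (Fin d) × Matrix (Fin d) (Fin d) ℝ)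
    (l : EuclideanSpace ℝ (Fin d) → ℝ) :
    EuclideanSpace ℝ (Fin d) × Matrix (Fin d) (Fin d) ℝ :=
  let g := gradient l p.1
  let A' := p.2 + Matrix.vecMulVec g.ofLp g.ofLp
  (genProj X A' (p.1 - γ⁻¹ • WithLp.toLp 2 (A'⁻¹.mulVec g.ofLp)), A')

theorem onsState_succ {d : ℕ} (X : Set (EuclideanSpace ℝ (Fin d))) (γ ε : ℝ)
    (x₁ : EuclideanSpace ℝ (Fin d)) (f : ℕ → EuclideanSpace ℝ (Fin d) → ℝ) (t : ℕ) :
    onsState X γ ε x₁ f (t + 1) = onsStep X γ (onsState X γ ε x₁ f t) (f t) := rfl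

theorem onsState_congr {d : ℕ} (X : Set (EuclideanSpace ℝ (Fin d))) (γ ε : ℝ)
    (x₁ : EuclideanSpace ℝ (Fin d)) {f f' : ℕ → EuclideanSpace ℝ (Fin d) → ℝ} {t : ℕ}
    (h : ∀ s < t, f s = f' s) : onsState X γ ε x₁ f t = onsState X γ ε x₁ f' t := by
  induction t with
  | zero => rfl
  | succ t ih =>
    rw [onsState_succ, onsState_succ, ih fun s hs => h s (by omega), h t (by omega)]

theorem ons_mem {d : ℕ} {X : Set (EuclideanSpace ℝ (Fin d))} (hX : IsCompact X) (γ ε : ℝ)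
    {x₁ : EuclideanSpace ℝ (Fin d)} (hx₁ : x₁ ∈ X)
    (f : ℕ → EuclideanSpace ℝ (Fin d) → ℝ) (t : ℕ) : ons X γ ε x₁ f t ∈ X := by
  cases t with
  | zero => exact hx₁
  | succ t => exact (genProj_spec ⟨x₁, hx₁⟩ hX _ _).1

/-- An adaptive adversary, with an internal state of type `σ`, can be played against the
Online Newton Step. -/
theorem exists_adaptive_losses {d : ℕ} (X : Set (EuclideanSpace ℝ (Fin d))) (γ ε : ℝ)
    (x₁ : EuclideanSpace ℝ (Fin d)) {σ : Type*} (init : σ)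
    (loss : ℕ → EuclideanSpace ℝ (Fin d) → σ → EuclideanSpace ℝ (Fin d) → ℝ)
    (next : ℕ → EuclideanSpace ℝ (Fin d) → σ → σ) :
    ∃ (f : ℕ → EuclideanSpace ℝ (Fin d) → ℝ) (s : ℕ → σ), s 0 = init ∧
      ∀ t, f t = loss t (ons X γ ε x₁ f t) (s t) ∧
        s (t + 1) = next t (ons X γ ε x₁ f t) (s t) := by
  -- Learner and adversary are run jointly; since the learner is deterministic, it reproduces the
  -- same run on the resulting fixed loss sequence.
  let F : ℕ → (EuclideanSpace ℝ (Fin d) × Matrix (Fin d) (Fin d) ℝ) × σ := fun t =>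
    Nat.rec ((x₁, ε • (1 : Matrix (Fin d) (Fin d) ℝ)), init)
      (fun t p => (onsStep X γ p.1 (loss t p.1.1 p.2), next t p.1.1 p.2)) t
  have hF : ∀ t, onsState X γ ε x₁ (fun t => loss t (F t).1.1 (F t).2) t = (F t).1 := by
    intro t
    induction t with
    | zero => rfl
    | succ t ih => rw [onsState_succ, ih]
  refine ⟨fun t => loss t (F t).1.1 (F t).2, fun t => (F t).2, rfl, fun t => ?_⟩
  simp only [ons, hF]
  exact ⟨trivial, rfl⟩

theorem le_regret {d : ℕ} {G : ℝ} {X : Set (EuclideanSpace ℝ (Fin d))} {T : ℕ}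
    {f : ℕ → EuclideanSpace ℝ (Fin d) → ℝ} (hX : IsCompact X) (hf : IsLossSequence G X T f)
    {u : EuclideanSpace ℝ (Fin d)} (hu : u ∈ X) {x : ℕ → EuclideanSpace ℝ (Fin d)} {c : ℝ}
    (hc : c ≤ ∑ t ∈ Finset.range T, (f t (x t) - f t u)) : c ≤ regret X T f x := by
  have hcont : ContinuousOn (fun u => ∑ t ∈ Finset.range T, f t u) X :=
    continuousOn_finsetSum _ fun t ht y hy =>
      (hf.differentiableAt t (Finset.mem_range.1 ht) y hy).continuousAt.continuousWithinAt
  have := csInf_le (hX.bddBelow_image hcont) (Set.mem_image_of_mem _ hu)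
  rw [Finset.sum_sub_distrib] at hc
  unfold regret
  linarith

/-! ### Boxes and functions of one coordinate. -/

theorem hasGradientAt_comp_coord {d : ℕ} (i : Fin d) {h : ℝ → ℝ} {h' : ℝ}
    {x : EuclideanSpace ℝ (Fin d)} (hh : HasDerivAt h h' (x i)) :
    HasGradientAt (fun x : EuclideanSpace ℝ (Fin d) => h (x i))
      (h' • EuclideanSpace.single i (1 : ℝ)) x := by
  rw [hasGradientAt_iff_hasFDerivAt]
  have h1 : HasFDerivAt (fun x : EuclideanSpace ℝ (Fin d) => x i)
      (EuclideanSpace.proj i : EuclideanSpace ℝ (Fin d) →L[ℝ] ℝ) x :=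
    (EuclideanSpace.proj i : EuclideanSpace ℝ (Fin d) →L[ℝ] ℝ).hasFDerivAt
  have h2 : (InnerProductSpace.toDual ℝ (EuclideanSpace ℝ (Fin d)))
      (h' • EuclideanSpace.single i (1 : ℝ)) =
      h' • (EuclideanSpace.proj i : EuclideanSpace ℝ (Fin d) →L[ℝ] ℝ) := by
    ext v
    simp [EuclideanSpace.inner_single_left]
  rw [h2]
  exact hh.comp_hasFDerivAt x h1

theorem gradient_comp_coord {d : ℕ} (i : Fin d) {h : ℝ → ℝ} {h' : ℝ}
    {x : EuclideanSpace ℝ (Fin d)} (hh : HasDerivAt h h' (x i)) :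
    gradient (fun x : EuclideanSpace ℝ (Fin d) => h (x i)) x =
      h' • EuclideanSpace.single i (1 : ℝ) :=
  (hasGradientAt_comp_coord i hh).gradient

theorem norm_gradient_comp_coord {d : ℕ} (i : Fin d) {h : ℝ → ℝ} {h' : ℝ}
    {x : EuclideanSpace ℝ (Fin d)} (hh : HasDerivAt h h' (x i)) :
    ‖gradient (fun x : EuclideanSpace ℝ (Fin d) => h (x i)) x‖ = |h'| := by
  rw [gradient_comp_coord i hh, norm_smul]
  simp

/-- The box with half-widths `w`. -/
def box {d : ℕ} (w : Fin d → ℝ) : Set (EuclideanSpace ℝ (Fin d)) := {x | ∀ i, |x i| ≤ w i}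

theorem convex_box {d : ℕ} (w : Fin d → ℝ) : Convex ℝ (box w) := by
  intro x hx y hy a b ha hb hab i
  have h1 := abs_le.1 (hx i)
  have h2 := abs_le.1 (hy i)
  simp only [PiLp.add_apply, PiLp.smul_apply, smul_eq_mul]
  have hb' : b = 1 - a := by linarith
  subst hb'
  rw [abs_le]
  constructor <;> nlinarith

theorem norm_le_sum_abs {d : ℕ} (x : EuclideanSpace ℝ (Fin d)) : ‖x‖ ≤ ∑ i, |x i| := by
  rw [EuclideanSpace.norm_eq]
  apply Real.sqrt_le_iff.2 ⟨by positivity, ?_⟩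
  simpa using Finset.sum_sq_le_sq_sum_of_nonneg (s := Finset.univ) (f := fun i => |x i|)
    fun i _ => abs_nonneg _

theorem isCompact_box {d : ℕ} (w : Fin d → ℝ) : IsCompact (box w) := by
  apply Metric.isCompact_of_isClosed_isBounded
  · have : box w = ⋂ i, {x : EuclideanSpace ℝ (Fin d) | |x i| ≤ w i} := by
      ext x; simp [box]
    rw [this]
    exact isClosed_iInter fun i => isClosed_le (by fun_prop) continuous_const
  · exact isBounded_iff_forall_norm_le.2 ⟨∑ i, w i, fun x hx =>
      (norm_le_sum_abs x).trans (Finset.sum_le_sum fun i _ => hx i)⟩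

theorem isDecisionSet_box {d : ℕ} {w : Fin d → ℝ} {D : ℝ} (hw : ∀ i, 0 ≤ w i)
    (hD : ∑ i, 2 * w i ≤ D) : IsDecisionSet D (box w) where
  nonempty := ⟨0, fun i => by simpa using hw i⟩
  convex := convex_box w
  isCompact := isCompact_box w
  dist_le x hx y hy := by
    refine ((norm_le_sum_abs _).trans (Finset.sum_le_sum fun i _ => ?_)).trans hD
    have := abs_sub (x i) (y i)
    have := hx i
    have := hy i
    simp only [PiLp.sub_apply]
    linarith

theorem convexOn_comp_coord {d : ℕ} {X : Set (EuclideanSpace ℝ (Fin d))} (hX : Convex ℝ X)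
    (i : Fin d) {S : Set ℝ} {h : ℝ → ℝ} (hh : ConvexOn ℝ S h) (hS : ∀ x ∈ X, x i ∈ S) :
    ConvexOn ℝ X (fun x => h (x i)) :=
  (hh.comp_linearMap
    (EuclideanSpace.proj i : EuclideanSpace ℝ (Fin d) →L[ℝ] ℝ).toLinearMap).subset hS hX

theorem concaveOn_comp_coord {d : ℕ} {X : Set (EuclideanSpace ℝ (Fin d))} (hX : Convex ℝ X)
    (i : Fin d) {S : Set ℝ} {h : ℝ → ℝ} (hh : ConcaveOn ℝ S h) (hS : ∀ x ∈ X, x i ∈ S) :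
    ConcaveOn ℝ X (fun x => h (x i)) :=
  (hh.comp_linearMap
    (EuclideanSpace.proj i : EuclideanSpace ℝ (Fin d) →L[ℝ] ℝ).toLinearMap).subset hS hX

/-- A Gaussian is concave up to its inflection points. -/
theorem concaveOn_gaussian {c z r : ℝ} (hc : 0 ≤ c) (hcr : c * r ^ 2 ≤ 1) :
    ConcaveOn ℝ (Set.Icc (z - r) (z + r)) (fun s => Real.exp (-(c / 2 * (s - z) ^ 2))) := by
  have hd : ∀ s, HasDerivAt (fun s => Real.exp (-(c / 2 * (s - z) ^ 2)))
      (Real.exp (-(c / 2 * (s - z) ^ 2)) * -(c * (s - z))) s := fun s => by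
    have : HasDerivAt (fun s => -(c / 2 * (s - z) ^ 2)) (-(c * (s - z))) s := by
      refine ((((hasDerivAt_id s).sub_const z).pow 2).const_mul (c / 2)).neg.congr_deriv ?_
      simp only [id]
      ring
    exact this.exp
  have hd2 : ∀ s, HasDerivAt (fun s => Real.exp (-(c / 2 * (s - z) ^ 2)) * -(c * (s - z)))
      (Real.exp (-(c / 2 * (s - z) ^ 2)) * (c * (c * (s - z) ^ 2 - 1))) s := fun s => by
    have := (hd s).mul ((((hasDerivAt_id s).sub_const z).const_mul c).neg)
    refine this.congr_deriv ?_
    simp only [id, Pi.neg_apply]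
    ring
  refine concaveOn_of_hasDerivWithinAt2_nonpos (convex_Icc _ _)
    (fun s _ => (hd s).continuousAt.continuousWithinAt)
    (fun s _ => (hd s).hasDerivWithinAt) (fun s _ => (hd2 s).hasDerivWithinAt) fun s hs => ?_
  rw [interior_Icc] at hs
  have : (s - z) ^ 2 ≤ r ^ 2 := by nlinarith [hs.1, hs.2]
  have : c * (s - z) ^ 2 ≤ 1 := (mul_le_mul_of_nonneg_left this hc).trans hcr
  have := mul_nonneg (Real.exp_pos (-(c / 2 * (s - z) ^ 2))).le
    (mul_nonneg hc (sub_nonneg.2 this))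
  linarith

/-! ### Logarithmic regret in one coordinate. -/

theorem log_le_sum_inv {s : ℝ} (hs : 0 ≤ s) (N : ℕ) :
    Real.log (s + N + 1) - Real.log (s + 1) ≤ ∑ n ∈ Finset.range N, 1 / (s + n + 1) := by
  induction N with
  | zero => simp
  | succ N ih =>
    rw [Finset.sum_range_succ]
    have ha : 0 < s + N + 1 := by positivity
    have h1 : Real.log ((s + N + 1 + 1) / (s + N + 1)) ≤ (s + N + 1 + 1) / (s + N + 1) - 1 :=
      Real.log_le_sub_one_of_pos (by positivity)
    rw [Real.log_div (by positivity) (by positivity)] at h1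
    have h2 : (s + N + 1 + 1) / (s + N + 1) - 1 = 1 / (s + N + 1) := by field_simp; ring
    push_cast
    rw [← add_assoc s]
    linarith

theorem sum_inv_sq_le {s : ℝ} (hs : 0 < s) (N : ℕ) :
    ∑ n ∈ Finset.range N, 1 / (s + n + 1) ^ 2 ≤ 1 / s - 1 / (s + N) := by
  induction N with
  | zero => simp
  | succ N ih =>
    rw [Finset.sum_range_succ]
    have h : 1 / (s + N + 1) ^ 2 ≤ 1 / (s + N) - 1 / (s + N + 1) := by
      rw [div_sub_div _ _ (by positivity) (by positivity),
        div_le_div_iff₀ (by positivity) (by positivity)]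
      have : (0:ℝ) ≤ s + N := by positivity
      nlinarith
    push_cast
    rw [← add_assoc s]
    linarith

/-- The noise `±b` of the adversary when the learner plays `x`, the running mean is `θ` with
weight `v` and the penalty is `κ`. -/
noncomputable def noise (b κ v x θ : ℝ) : ℝ := if 0 ≤ x - θ + κ * θ / v then -b else b

theorem noise_sq (b κ v x θ : ℝ) : noise b κ v x θ ^ 2 = b ^ 2 := by
  unfold noise; split_ifs <;> ring

theorem abs_noise {b : ℝ} (hb : 0 ≤ b) (κ v x θ : ℝ) : |noise b κ v x θ| = b := by
  unfold noise; split_ifs <;> simp [abs_of_nonneg hb]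

/-- This product, up to a factor `-2`, is the only part of the potential's increment that depends on
the sign of the noise. -/
theorem noise_mul_le {b : ℝ} (hb : 0 ≤ b) (κ v x θ : ℝ) :
    noise b κ v x θ * (x - θ + κ * θ / v) ≤ 0 := by
  unfold noise; split_ifs <;> nlinarith

/-- The centre of the loss of an active round. -/
noncomputable def centre (b κ v x θ : ℝ) : ℝ := θ + noise b κ v x θ

/-- The update of the running mean, which is frozen once it has left `(-ρ, ρ)`. -/
noncomputable def nextMean (ρ b κ v x θ : ℝ) : ℝ :=
  if |θ| < ρ then θ + noise b κ v x θ / v else θ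

/-- Each step is at most `b / s ≤ ρ`, so the mean overshoots `ρ` by at most `ρ` before it is frozen.
-/
theorem abs_mean_le {ρ b κ s : ℝ} {N : ℕ} {x θ : ℕ → ℝ} (hb : 0 ≤ b) (hs : 0 < s)
    (hρ : 0 ≤ ρ) (hbs : b ≤ s * ρ) (h0 : θ 0 = 0)
    (hθ : ∀ n < N, θ (n + 1) = nextMean ρ b κ (s + n + 1) (x n) (θ n)) :
    ∀ n ≤ N, |θ n| ≤ 2 * ρ := by
  intro n hn
  induction n with
  | zero => rw [h0]; simpa using hρ
  | succ n ih =>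
    rw [hθ n hn, nextMean]
    split_ifs with h
    · have h1 : |noise b κ (s + n + 1) (x n) (θ n) / (s + n + 1)| ≤ ρ := by
        rw [abs_div, abs_noise hb, abs_of_pos (by positivity : 0 < s + n + 1),
          div_le_iff₀ (by positivity)]
        nlinarith [(Nat.cast_nonneg n : (0:ℝ) ≤ n)]
      have := abs_add_le (θ n) (noise b κ (s + n + 1) (x n) (θ n) / (s + n + 1))
      linarith
    · exact ih (by omega)

/-- The regret that the adversary forces in one coordinate. -/
theorem block_regret {ρ b κ s : ℝ} {N : ℕ} {x θ : ℕ → ℝ} (hb : 0 < b) (hs : 0 < s)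
    (hρ : 0 < ρ) (hbs : 2 * b ^ 2 ≤ s * ρ ^ 2)
    (hκ : κ * ρ ^ 2 = b ^ 2 * ∑ n ∈ Finset.range N, 1 / (s + n + 1)) (h0 : θ 0 = 0)
    (hθ : ∀ n < N, θ (n + 1) = nextMean ρ b κ (s + n + 1) (x n) (θ n)) :
    b ^ 2 / 2 * ∑ n ∈ Finset.range N, 1 / (s + n + 1) ≤
      ∑ n ∈ Finset.range N, if |θ n| < ρ then
        (x n - centre b κ (s + n + 1) (x n) (θ n)) ^ 2 -
          (θ N - centre b κ (s + n + 1) (x n) (θ n)) ^ 2 else 0 := by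
  set H := ∑ n ∈ Finset.range N, 1 / (s + n + 1) with hH
  have hH0 : 0 ≤ H := Finset.sum_nonneg fun n _ => by positivity
  have hκ0 : 0 ≤ κ := by
    have : 0 ≤ κ * ρ ^ 2 := hκ ▸ by positivity
    exact nonneg_of_mul_nonneg_left this (by positivity)
  -- The total variance of the walk `θ` is at most `b² / s ≤ ρ² / 2`, so compensating it costs at
  -- most half of the gain `b² H`.
  have hκs : ∀ m, κ * (b ^ 2 * ∑ n ∈ Finset.range m, 1 / (s + n + 1) ^ 2) ≤ b ^ 2 / 2 * H := by
    intro m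
    have h1 : b ^ 2 * ∑ n ∈ Finset.range m, 1 / (s + n + 1) ^ 2 ≤ ρ ^ 2 / 2 := by
      have h2 := sum_inv_sq_le hs m
      have h3 : (0:ℝ) ≤ 1 / (s + m) := by positivity
      calc _ ≤ b ^ 2 * (1 / s) := by gcongr; linarith
        _ ≤ ρ ^ 2 / 2 := by
          rw [mul_one_div, div_le_iff₀ hs]; linarith
    have := mul_le_mul_of_nonneg_left h1 hκ0
    linarith
  let P : ℕ → ℝ → ℝ := fun m u => ∑ n ∈ Finset.range m, if |θ n| < ρ then
        (x n - centre b κ (s + n + 1) (x n) (θ n)) ^ 2 -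
          (u - centre b κ (s + n + 1) (x n) (θ n)) ^ 2 else 0
  -- While active, the bound holds for every comparator `u`: `s u² - (s + m)(u - θ m)²` comes from
  -- completing the square around the regularized mean. After stopping, only the frozen mean is
  -- needed as comparator.
  have key : ∀ m ≤ N,
      (|θ m| < ρ ∧ ∀ u, s * u ^ 2 - (s + m) * (u - θ m) ^ 2
        + b ^ 2 * (∑ n ∈ Finset.range m, 1 / (s + n + 1))
        + κ * (θ m ^ 2 - b ^ 2 * ∑ n ∈ Finset.range m, 1 / (s + n + 1) ^ 2) ≤ P m u) ∨
      (ρ ≤ |θ m| ∧ b ^ 2 / 2 * H ≤ P m (θ m)) := by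
    intro m hm
    induction m with
    | zero =>
      left
      simp [h0, hρ, P]
    | succ m ih =>
      rcases ih (by omega) with ⟨ha, h⟩ | ⟨ha, h⟩
      · have hθm := hθ m hm
        have hPs : ∀ u, P (m + 1) u = P m u +
            ((x m - centre b κ (s + m + 1) (x m) (θ m)) ^ 2 -
              (u - centre b κ (s + m + 1) (x m) (θ m)) ^ 2) := by
          intro u
          simp only [P, Finset.sum_range_succ, if_pos ha]
        rw [nextMean, if_pos ha] at hθm
        have hv : 0 < s + m + 1 := by positivity
        have h4 := noise_mul_le hb.le κ (s + m + 1) (x m) (θ m)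
        have h5 := noise_sq b κ (s + m + 1) (x m) (θ m)
        have hstep : ∀ u, s * u ^ 2 - (s + (m + 1 : ℕ)) * (u - θ (m + 1)) ^ 2
            + b ^ 2 * (∑ n ∈ Finset.range (m + 1), 1 / (s + n + 1))
            + κ * (θ (m + 1) ^ 2 - b ^ 2 * ∑ n ∈ Finset.range (m + 1), 1 / (s + n + 1) ^ 2)
              ≤ P (m + 1) u := by
          intro u
          have h6 := h u
          rw [hPs, Finset.sum_range_succ, Finset.sum_range_succ, hθm, centre]
          generalize noise b κ (s + m + 1) (x m) (θ m) = ξ at *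
          push_cast
          rw [← add_assoc s]
          have hsm : s + (m : ℝ) = (s + m + 1) - 1 := by ring
          rw [hsm] at h6
          generalize s + (m : ℝ) + 1 = v at *
          generalize ∑ n ∈ Finset.range m, 1 / (s + (n : ℝ) + 1) = H1 at *
          generalize ∑ n ∈ Finset.range m, 1 / (s + (n : ℝ) + 1) ^ 2 = H2 at *
          have e1 : v * (u - (θ m + ξ / v)) ^ 2 =
              v * (u - θ m) ^ 2 - 2 * ξ * (u - θ m) + b ^ 2 * (1 / v) := by
            rw [← h5]; field_simp; ring
          have e2 : κ * ((θ m + ξ / v) ^ 2 - b ^ 2 * (H2 + 1 / v ^ 2)) =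
              κ * (θ m ^ 2 - b ^ 2 * H2) + 2 * (ξ * (κ * θ m / v)) := by
            rw [← h5]; field_simp; ring
          rw [e1, e2]
          -- The slack is `(x m - θ m)²` minus twice the product bounded by `h4`.
          nlinarith [sq_nonneg (x m - θ m)]
        by_cases hb' : |θ (m + 1)| < ρ
        · exact Or.inl ⟨hb', hstep⟩
        · right
          push Not at hb'
          -- On exit `κ θ² ≥ κ ρ² = b² H`, which absorbs the variance cost and leaves `b² H / 2`.
          refine ⟨hb', ?_⟩
          have h7 := hstep (θ (m + 1))
          have h8 := hκs (m + 1)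
          have h9 : 0 ≤ b ^ 2 * (∑ n ∈ Finset.range (m + 1), 1 / (s + (n : ℝ) + 1)) :=
            mul_nonneg (by positivity) (Finset.sum_nonneg fun n _ => by positivity)
          have h10 : ρ ^ 2 ≤ θ (m + 1) ^ 2 := by
            rw [← sq_abs (θ (m + 1))]; gcongr
          have h11 := mul_le_mul_of_nonneg_left h10 hκ0
          have h12 : 0 ≤ s * θ (m + 1) ^ 2 := by positivity
          rw [sub_self] at h7
          nlinarith
      · right
        have hθm := hθ m hm
        rw [nextMean, if_neg (not_lt.2 ha)] at hθm
        rw [hθm]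
        refine ⟨ha, ?_⟩
        simp only [P, Finset.sum_range_succ, if_neg (not_lt.2 ha), add_zero]
        exact h
  rcases key N le_rfl with ⟨-, h⟩ | ⟨-, h⟩
  · have h7 := h (θ N)
    have h8 := hκs N
    have h12 : 0 ≤ s * θ N ^ 2 := by positivity
    have h13 : 0 ≤ κ * θ N ^ 2 := by positivity
    rw [sub_self] at h7
    refine le_trans ?_ h7
    rw [← hH]
    linarith
  · exact h

/-! ### Exp-concave quadratic losses, one block of rounds per coordinate. -/

/-- The squared loss with curvature `l` and centre `z` in the coordinate `i`. -/
noncomputable def quadLoss {d : ℕ} (l : ℝ) (i : Fin d) (z : ℝ) :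
    EuclideanSpace ℝ (Fin d) → ℝ := fun x => l / 2 * (x i - z) ^ 2

theorem hasDerivAt_quad (l z s : ℝ) :
    HasDerivAt (fun s => l / 2 * (s - z) ^ 2) (l * (s - z)) s := by
  refine ((((hasDerivAt_id s).sub_const z).pow 2).const_mul (l / 2)).congr_deriv ?_
  simp only [id]
  ring

theorem convexOn_quad {l : ℝ} (hl : 0 ≤ l) (z : ℝ) :
    ConvexOn ℝ Set.univ (fun s : ℝ => l / 2 * (s - z) ^ 2) := by
  refine ⟨convex_univ, fun x _ y _ a c ha hc hac => ?_⟩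
  simp only [smul_eq_mul]
  have : c = 1 - a := by linarith
  subst this
  nlinarith [mul_nonneg hl (mul_nonneg (mul_nonneg ha hc) (sq_nonneg (x - y)))]

/-- The properties of a single loss required of an exp-concave loss sequence. -/
structure IsExpConcaveLoss {d : ℕ} (G α : ℝ) (X : Set (EuclideanSpace ℝ (Fin d)))
    (l : EuclideanSpace ℝ (Fin d) → ℝ) : Prop where
  convexOn : ConvexOn ℝ X l
  differentiableAt : ∀ x ∈ X, DifferentiableAt ℝ l x
  norm_gradient_le : ∀ x ∈ X, ‖gradient l x‖ ≤ G
  isExpConcave : IsExpConcave X α l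

theorem isExpConcaveLoss_zero {d : ℕ} {G : ℝ} (hG : 0 ≤ G) (α : ℝ)
    {X : Set (EuclideanSpace ℝ (Fin d))} (hX : Convex ℝ X) : IsExpConcaveLoss G α X 0 where
  convexOn := convexOn_const 0 hX
  differentiableAt x _ := differentiableAt_const 0
  norm_gradient_le x _ := by
    have : gradient (0 : EuclideanSpace ℝ (Fin d) → ℝ) x = 0 := gradient_fun_const x 0
    rw [this, norm_zero]
    exact hG
  isExpConcave := by
    unfold IsExpConcave
    simpa using concaveOn_const (1 : ℝ) hX

/-- The exponential is a Gaussian in one coordinate, and `α l r² ≤ 1` keeps `X` between its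
inflection points. -/
theorem isExpConcaveLoss_quadLoss {d : ℕ} {G α l r z : ℝ} {i : Fin d} (hα : 0 ≤ α) (hl : 0 ≤ l)
    (hαl : α * l * r ^ 2 ≤ 1) (hlG : l * r ≤ G) {X : Set (EuclideanSpace ℝ (Fin d))}
    (hX : Convex ℝ X) (hz : ∀ x ∈ X, |x i - z| ≤ r) : IsExpConcaveLoss G α X (quadLoss l i z) where
  convexOn := convexOn_comp_coord hX i (convexOn_quad hl z) fun _ _ => Set.mem_univ _
  differentiableAt x _ := (hasGradientAt_comp_coord i (hasDerivAt_quad l z (x i))).differentiableAt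
  norm_gradient_le x hx := by
    unfold quadLoss
    rw [norm_gradient_comp_coord i (hasDerivAt_quad l z (x i)), abs_mul, abs_of_nonneg hl]
    exact (mul_le_mul_of_nonneg_left (hz x hx) hl).trans hlG
  isExpConcave := by
    have h := concaveOn_comp_coord hX i
      (concaveOn_gaussian (z := z) (mul_nonneg hα hl) hαl) fun x hx => by
        have := abs_le.1 (hz x hx)
        exact ⟨by linarith, by linarith⟩
    unfold IsExpConcave quadLoss
    convert h using 4
    ring

theorem sum_range_mul {M : Type*} [AddCommMonoid M] (g : ℕ → M) (d N : ℕ) :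
    ∑ t ∈ Finset.range (d * N), g t =
      ∑ i ∈ Finset.range d, ∑ n ∈ Finset.range N, g (i * N + n) := by
  induction d with
  | zero => simp
  | succ d ih => rw [Nat.succ_mul, Finset.sum_range_add, ih, Finset.sum_range_succ]

/-- The loss of round `t` when the coordinates are treated one after the other, for `N` rounds
each, and `θ` is the current running mean. -/
noncomputable def blockLoss {d : ℕ} (ρ b κ s l : ℝ) (N t : ℕ) (x : EuclideanSpace ℝ (Fin d))
    (θ : ℝ) : EuclideanSpace ℝ (Fin d) → ℝ :=
  if h : t / N < d then
    if |if t % N = 0 then 0 else θ| < ρ then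
      quadLoss l ⟨t / N, h⟩ (centre b κ (s + (t % N : ℕ) + 1) (x ⟨t / N, h⟩)
        (if t % N = 0 then 0 else θ))
    else 0
  else 0

/-- The running mean after round `t`. -/
noncomputable def blockNext {d : ℕ} (ρ b κ s : ℝ) (N t : ℕ) (x : EuclideanSpace ℝ (Fin d))
    (θ : ℝ) : ℝ :=
  if h : t / N < d then
    nextMean ρ b κ (s + (t % N : ℕ) + 1) (x ⟨t / N, h⟩) (if t % N = 0 then 0 else θ)
  else θ

theorem isExpConcaveLoss_blockLoss {d : ℕ} {w : Fin d → ℝ} {ρ b κ s l G α R : ℝ} (hα : 0 ≤ α)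
    (hG : 0 ≤ G) (hb : 0 ≤ b) (hl : 0 ≤ l) (hαl : α * l * (R + ρ + b) ^ 2 ≤ 1)
    (hlG : l * (R + ρ + b) ≤ G) (hw : ∀ i, w i ≤ R) (N t : ℕ) (x : EuclideanSpace ℝ (Fin d))
    (θ : ℝ) : IsExpConcaveLoss G α (box w) (blockLoss ρ b κ s l N t x θ) := by
  unfold blockLoss
  generalize (if t % N = 0 then 0 else θ) = θ'
  split_ifs with h1 h2
  · refine isExpConcaveLoss_quadLoss hα hl hαl hlG (convex_box w) fun y hy => ?_
    have h3 := abs_le.1 ((hy ⟨t / N, h1⟩).trans (hw _))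
    unfold centre
    generalize hξ : noise b κ _ _ _ = ξ
    have h4 := abs_le.1 (hξ ▸ (abs_noise hb _ _ _ _).le : |ξ| ≤ b)
    have h5 := abs_lt.1 h2
    rw [abs_le]
    constructor <;> linarith
  · exact isExpConcaveLoss_zero hG α (convex_box w)
  · exact isExpConcaveLoss_zero hG α (convex_box w)

theorem exists_log_regret {d : ℕ} {w : Fin d → ℝ} {ρ b s l G α R : ℝ} (γ ε : ℝ) (hα : 0 ≤ α)
    (hG : 0 ≤ G) (hb : 0 < b) (hl : 0 ≤ l) (hs : 0 < s) (hρ : 0 < ρ) (hbs : b ≤ s * ρ)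
    (hbs2 : 2 * b ^ 2 ≤ s * ρ ^ 2) (hαl : α * l * (R + ρ + b) ^ 2 ≤ 1)
    (hlG : l * (R + ρ + b) ≤ G) (hwR : ∀ i, w i ≤ R) (hwρ : ∀ i, 2 * ρ ≤ w i) {N T : ℕ}
    (hN : 0 < N) (hT : d * N ≤ T) (x₁ : EuclideanSpace ℝ (Fin d)) :
    ∃ f : ℕ → EuclideanSpace ℝ (Fin d) → ℝ, (∀ t, IsExpConcaveLoss G α (box w) (f t)) ∧
      d * (l / 2 * (b ^ 2 / 2 * ∑ n ∈ Finset.range N, 1 / (s + n + 1))) ≤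
        regret (box w) T f (ons (box w) γ ε x₁ f) := by
  set κ := b ^ 2 * (∑ n ∈ Finset.range N, 1 / (s + n + 1)) / ρ ^ 2 with hκ
  obtain ⟨f, st, -, h⟩ := exists_adaptive_losses (box w) γ ε x₁ (0 : ℝ)
    (blockLoss ρ b κ s l N) (blockNext ρ b κ s N)
  have hf : ∀ t, IsExpConcaveLoss G α (box w) (f t) := fun t => by
    rw [(h t).1]
    exact isExpConcaveLoss_blockLoss hα hG hb.le hl hαl hlG hwR N t _ _
  refine ⟨f, hf, ?_⟩
  set x := ons (box w) γ ε x₁ f with hx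
  -- At the start of a block the state still holds the previous block's mean, hence the reset at `n
  -- = 0`; at `n = N` it is the final mean of block `i`.
  let θ : ℕ → ℕ → ℝ := fun i n => if n = 0 then 0 else st (i * N + n)
  have hdiv : ∀ i n, n < N → (i * N + n) / N = i := fun i n hn => by
    rw [mul_comm, Nat.mul_add_div hN, Nat.div_eq_of_lt hn, add_zero]
  have hmod : ∀ i n, n < N → (i * N + n) % N = n := fun i n hn => by
    rw [mul_comm, Nat.mul_add_mod, Nat.mod_eq_of_lt hn]
  have hθ0 : ∀ i, θ i 0 = 0 := fun i => if_pos rfl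
  have hθ : ∀ (i : Fin d) n, n < N →
      θ i (n + 1) = nextMean ρ b κ (s + n + 1) (x (i * N + n) i) (θ i n) := by
    intro i n hn
    have h1 : θ i (n + 1) = st (i * N + n + 1) := if_neg (by omega)
    rw [h1, (h (i * N + n)).2]
    simp only [blockNext, hdiv i n hn, hmod i n hn, i.2, dite_true, θ]
  have hloss : ∀ (i : Fin d) n, n < N → f (i * N + n) =
      if |θ i n| < ρ then quadLoss l i (centre b κ (s + n + 1) (x (i * N + n) i) (θ i n))
      else 0 := by
    intro i n hn
    rw [(h (i * N + n)).1]
    simp only [blockLoss, hdiv i n hn, hmod i n hn, i.2, dite_true, θ]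
  -- The blocks involve different coordinates, so a single comparator takes the final mean of every
  -- block.
  let u : EuclideanSpace ℝ (Fin d) := WithLp.toLp 2 fun i => θ i N
  have hu : u ∈ box w := fun i =>
    (abs_mean_le hb.le hs hρ.le hbs (hθ0 i) (hθ i) N le_rfl).trans (hwρ i)
  refine le_regret (isCompact_box w) ⟨fun t _ => (hf t).convexOn,
    fun t _ => (hf t).differentiableAt, fun t _ => (hf t).norm_gradient_le⟩ hu ?_
  have hsub : ∑ t ∈ Finset.range (d * N), (f t (x t) - f t u) =
      ∑ t ∈ Finset.range T, (f t (x t) - f t u) := by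
    refine Finset.sum_subset (Finset.range_mono hT) fun t _ ht => ?_
    have : ¬ t / N < d := fun hlt => ht (Finset.mem_range.2 ((Nat.div_lt_iff_lt_mul hN).1 hlt))
    rw [(h t).1]
    simp [blockLoss, this]
  rw [← hsub, sum_range_mul]
  have hblock : ∀ i : Fin d, l / 2 * (b ^ 2 / 2 * ∑ n ∈ Finset.range N, 1 / (s + n + 1)) ≤
      ∑ n ∈ Finset.range N, (f (i * N + n) (x (i * N + n)) - f (i * N + n) u) := by
    intro i
    have h1 := mul_le_mul_of_nonneg_left (block_regret (κ := κ)
      (x := fun n => x (i * N + n) i) hb hs hρ hbs2 (by rw [hκ]; field_simp) (hθ0 i) (hθ i))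
      (by positivity : 0 ≤ l / 2)
    refine h1.trans (le_of_eq ?_)
    rw [Finset.mul_sum]
    refine Finset.sum_congr rfl fun n hn => ?_
    rw [hloss i n (Finset.mem_range.1 hn)]
    split_ifs
    · simp only [quadLoss, u]
      ring
    · simp
  calc _ = ∑ i : Fin d, l / 2 * (b ^ 2 / 2 * ∑ n ∈ Finset.range N, 1 / (s + n + 1)) := by simp
    _ ≤ _ := (Finset.sum_le_sum fun i _ => hblock i).trans_eq <|
      Fin.sum_univ_eq_sum_range (fun i => ∑ n ∈ Finset.range N,
        (f (i * N + n) (x (i * N + n)) - f (i * N + n) u)) d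

/-! ### Linear regret from contaminated rounds. -/

/-- The linear losses with slopes `c t` in the coordinate `0`. -/
def linearLoss {d : ℕ} [NeZero d] (c : ℕ → ℝ) (t : ℕ) : EuclideanSpace ℝ (Fin d) → ℝ :=
  fun x => c t * x 0

theorem gradient_linearLoss {d : ℕ} [NeZero d] (c : ℕ → ℝ) (t : ℕ)
    (x : EuclideanSpace ℝ (Fin d)) :
    gradient (linearLoss c t) x = c t • EuclideanSpace.single 0 (1 : ℝ) :=
  gradient_comp_coord 0 (h := fun s => c t * s)
    (((hasDerivAt_id (x 0)).const_mul (c t)).congr_deriv (mul_one _))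

theorem isLossSequence_linearLoss {d : ℕ} [NeZero d] {c : ℕ → ℝ} {G : ℝ}
    (hc : ∀ t, |c t| ≤ G) {X : Set (EuclideanSpace ℝ (Fin d))} (hX : Convex ℝ X) (T : ℕ) :
    IsLossSequence G X T (linearLoss c) where
  convexOn t _ := convexOn_comp_coord hX 0 (S := Set.univ) (h := fun s => c t * s)
    ((LinearMap.mulLeft ℝ (c t)).convexOn convex_univ) fun _ _ => Set.mem_univ _
  differentiableAt t _ x _ := by unfold linearLoss; fun_prop
  norm_gradient_le t _ x _ := by
    rw [gradient_linearLoss, norm_smul]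
    simpa using hc t

/-- The matrix of the Online Newton Step on the losses `linearLoss c`. -/
theorem onsState_linearLoss {d : ℕ} [NeZero d] (X : Set (EuclideanSpace ℝ (Fin d))) (γ ε : ℝ)
    (x₁ : EuclideanSpace ℝ (Fin d)) (c : ℕ → ℝ) (t : ℕ) :
    (onsState X γ ε x₁ (linearLoss c) t).2 =
      Matrix.diagonal fun i => ε + if i = 0 then ∑ s ∈ Finset.range t, c s ^ 2 else 0 := by
  induction t with
  | zero =>
    ext i j
    by_cases h : i = j <;> simp [onsState, Matrix.diagonal, h]
  | succ t ih =>
    rw [onsState_succ]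
    simp only [onsStep, ih, gradient_linearLoss]
    ext i j
    rw [Finset.sum_range_succ]
    by_cases h : i = j
    · subst h
      by_cases h0 : i = 0
      · subst h0
        simp [Matrix.vecMulVec_apply]
        ring
      · simp [Matrix.vecMulVec_apply, h0]
    · by_cases h0 : i = 0
      · have : j ≠ 0 := fun hj => h (h0.trans hj.symm)
        simp [Matrix.vecMulVec_apply, h, this]
      · simp [Matrix.vecMulVec_apply, h, h0]

theorem sqNorm_diagonal {d : ℕ} (a : Fin d → ℝ) (v : EuclideanSpace ℝ (Fin d)) :
    sqNorm (Matrix.diagonal a) v = ∑ i, a i * v i ^ 2 := by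
  simp only [sqNorm, dotProduct, Matrix.mulVec_diagonal]
  exact Finset.sum_congr rfl fun i _ => by ring

/-- The displacement of the Online Newton Step in the coordinate `0`: it goes against the slope, by
at most twice the length of the Newton step. -/
theorem ons_displacement {d : ℕ} [NeZero d] {w : Fin d → ℝ} {γ ε : ℝ} (hε : 0 < ε)
    {x₁ : EuclideanSpace ℝ (Fin d)} (hx₁ : x₁ ∈ box w) (c : ℕ → ℝ) (t : ℕ) :
    (ons (box w) γ ε x₁ (linearLoss c) (t + 1) 0 - ons (box w) γ ε x₁ (linearLoss c) t 0) ^ 2 +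
      2 * (γ⁻¹ * (c t / (ε + ∑ s ∈ Finset.range (t + 1), c s ^ 2))) *
        (ons (box w) γ ε x₁ (linearLoss c) (t + 1) 0 -
          ons (box w) γ ε x₁ (linearLoss c) t 0) ≤ 0 := by
  have hmem := ons_mem (isCompact_box w) γ ε hx₁ (linearLoss c)
  have hA := onsState_linearLoss (box w) γ ε x₁ c (t + 1)
  set a : Fin d → ℝ := fun i => ε + if i = 0 then ∑ s ∈ Finset.range (t + 1), c s ^ 2 else 0
    with ha
  have ha0 : ∀ i, 0 < a i := fun i => by
    have : 0 ≤ ∑ s ∈ Finset.range (t + 1), c s ^ 2 := Finset.sum_nonneg fun _ _ => sq_nonneg _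
    simp only [ha]
    split_ifs <;> linarith
  set x := ons (box w) γ ε x₁ (linearLoss c) t with hx
  set x' := ons (box w) γ ε x₁ (linearLoss c) (t + 1) with hx'
  set y : EuclideanSpace ℝ (Fin d) := x - γ⁻¹ • WithLp.toLp 2 ((Matrix.diagonal a)⁻¹.mulVec
    (c t • EuclideanSpace.single (0 : Fin d) (1 : ℝ)).ofLp) with hy
  have hproj : x' = genProj (box w) (Matrix.diagonal a) y := by
    rw [onsState_succ] at hA
    simp only [onsStep, gradient_linearLoss] at hA
    rw [hx', ons, onsState_succ]
    simp only [onsStep, gradient_linearLoss, hA]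
    rfl
  have hinv : (Matrix.diagonal a)⁻¹ = Matrix.diagonal fun i => (a i)⁻¹ := by
    apply Matrix.inv_eq_left_inv
    rw [Matrix.diagonal_mul_diagonal, ← Matrix.diagonal_one]
    congr 1
    ext i
    exact inv_mul_cancel₀ (ha0 i).ne'
  have hy0 : y 0 = x 0 - γ⁻¹ * (c t / a 0) := by
    rw [hy, hinv]
    simp [Matrix.mulVec_diagonal]
    left
    ring
  -- Undoing the move in coordinate `0` alone stays in the box. As the matrix is diagonal,
  -- minimality of the projection against `z` becomes a scalar inequality.
  let z : EuclideanSpace ℝ (Fin d) := WithLp.toLp 2 (Function.update x'.ofLp 0 (x 0))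
  have hz : z ∈ box w := fun i => by
    by_cases hi : i = 0
    · subst hi
      simpa [z] using hmem t 0
    · simpa [z, hi] using hmem (t + 1) i
  have hle := (genProj_spec ⟨x₁, hx₁⟩ (isCompact_box w) (Matrix.diagonal a) y).2 z hz
  rw [← hproj, sqNorm_diagonal, sqNorm_diagonal,
    ← Finset.add_sum_erase _ _ (Finset.mem_univ (0 : Fin d)),
    ← Finset.add_sum_erase _ _ (Finset.mem_univ (0 : Fin d))] at hle
  have hrest : ∑ i ∈ Finset.univ.erase (0 : Fin d), a i * (y - x') i ^ 2 =
      ∑ i ∈ Finset.univ.erase (0 : Fin d), a i * (y - z) i ^ 2 :=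
    Finset.sum_congr rfl fun i hi => by simp [z, (Finset.mem_erase.1 hi).1]
  rw [hrest, add_le_add_iff_right] at hle
  have h3 := le_of_mul_le_mul_left hle (ha0 0)
  have ea : a 0 = ε + ∑ s ∈ Finset.range (t + 1), c s ^ 2 := by simp [ha]
  simp only [PiLp.sub_apply, hy0, z, Function.update_self] at h3
  rw [← ea]
  nlinarith

/-- Alternating slopes `±G` for `q` rounds, then slope `-η` for `q` rounds, then zero. -/
noncomputable def slopes (G η : ℝ) (q t : ℕ) : ℝ :=
  if t < q then (if t % 2 = 0 then G else -G) else if t < 2 * q then -η else 0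

theorem abs_slopes_le {G η : ℝ} (hG : 0 ≤ G) (hη : |η| ≤ G) (q t : ℕ) :
    |slopes G η q t| ≤ G := by
  unfold slopes
  split_ifs <;> simp [abs_of_nonneg hG, hη, hG]

/-- The regret of the Online Newton Step on the losses with slopes `slopes G (σ * η) q`, when the
sign `σ` points away from the point played in round `q`. -/
theorem linear_regret {d : ℕ} [NeZero d] {w : Fin d → ℝ} {γ ε G η σ : ℝ} (hw : ∀ i, 0 ≤ w i)
    (hγ : 0 < γ) (hε : 0 < ε) (hG : 0 < G) (hη : 0 ≤ η) (hηG : η ≤ G)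
    (hηw : η ≤ γ * G ^ 2 * w 0 / 4) (hσ : σ ^ 2 = 1) {x₁ : EuclideanSpace ℝ (Fin d)}
    (hx₁ : x₁ ∈ box w) {p T : ℕ} (hT : 2 * (2 * p) ≤ T)
    (hq : σ * ons (box w) γ ε x₁ (linearLoss (slopes G (σ * η) (2 * p))) (2 * p) 0 ≤ 0) :
    2 * p * (η * (w 0 / 2)) ≤ regret (box w) T (linearLoss (slopes G (σ * η) (2 * p)))
      (ons (box w) γ ε x₁ (linearLoss (slopes G (σ * η) (2 * p)))) := by
  have hσ1 : |σ| = 1 := by rw [← sq_eq_sq₀ (abs_nonneg _) zero_le_one, sq_abs, hσ, one_pow]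
  have hc := abs_slopes_le (η := σ * η) hG.le 
    (by rwa [abs_mul, hσ1, one_mul, abs_of_nonneg hη]) (2 * p)
  set c := slopes G (σ * η) (2 * p) with hcdef
  have hdisp := ons_displacement (γ := γ) hε hx₁ c
  set x := ons (box w) γ ε x₁ (linearLoss c) with hx
  let u : EuclideanSpace ℝ (Fin d) := EuclideanSpace.single 0 (σ * w 0)
  have hu : u ∈ box w := fun i => by
    by_cases hi : i = 0
    · subst hi
      simp [u, abs_mul, hσ1, abs_of_nonneg (hw 0)]
    · simpa [u, hi] using hw i
  refine le_regret (isCompact_box w) (isLossSequence_linearLoss hc (convex_box w) T) hu ?_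
  have hS : ∀ t, 0 ≤ ∑ s ∈ Finset.range t, c s ^ 2 := fun t => Finset.sum_nonneg fun _ _ =>
    sq_nonneg _
  have hu0 : u 0 = σ * w 0 := by simp [u]
  have hsub : ∑ t ∈ Finset.range (2 * p + 2 * p), (linearLoss c t (x t) - linearLoss c t u) =
      ∑ t ∈ Finset.range T, (linearLoss c t (x t) - linearLoss c t u) := by
    refine Finset.sum_subset (Finset.range_mono (by omega)) fun t _ ht => ?_
    rw [Finset.mem_range] at ht
    have : c t = 0 := by
      rw [hcdef, slopes, if_neg (by omega), if_neg (by omega)]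
    simp [linearLoss, this]
  rw [← hsub, Finset.sum_range_add]
  -- In each pair of slopes `G, -G` the comparator cancels, and the learner loses because the first
  -- slope pushes it down.
  have h1 : 0 ≤ ∑ t ∈ Finset.range (2 * p), (linearLoss c t (x t) - linearLoss c t u) := by
    rw [mul_comm 2 p, sum_range_mul]
    refine Finset.sum_nonneg fun i hi => ?_
    have hi := Finset.mem_range.1 hi
    have hce : c (i * 2) = G := by
      rw [hcdef, slopes, if_pos (by omega), if_pos (by omega)]
    have hco : c (i * 2 + 1) = -G := by
      rw [hcdef, slopes, if_pos (by omega), if_neg (by omega)]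
    simp only [Finset.sum_range_succ, Finset.sum_range_zero, linearLoss, zero_add, add_zero,
      hce, hco]
    have h2 := hdisp (i * 2)
    rw [hce] at h2
    have h3 : 0 < γ⁻¹ * (G / (ε + ∑ s ∈ Finset.range (i * 2 + 1), c s ^ 2)) := by
      have := hS (i * 2 + 1)
      positivity
    have h4 : x (i * 2 + 1) 0 - x (i * 2) 0 ≤ 0 := by
      by_contra! h
      have := mul_pos h3 h
      have := sq_nonneg (x (i * 2 + 1) 0 - x (i * 2) 0)
      linarith
    nlinarith
  have hcq : ∀ t, t < 2 * p → c (2 * p + t) = -(σ * η) := fun t ht => by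
    rw [hcdef, slopes, if_neg (by omega), if_pos (by omega)]
  have hSq : ∑ s ∈ Finset.range (2 * p), c s ^ 2 = 2 * p * G ^ 2 := by
    rw [Finset.sum_congr rfl (g := fun _ => G ^ 2)]
    · simp
    · intro s hs
      rw [hcdef, slopes, if_pos (Finset.mem_range.1 hs)]
      split_ifs <;> ring
  -- The first phase makes the matrix entry at least `2 p G²`, so each move towards `σ * w 0` is at
  -- most `w 0 / (4 p)`. Over `2 p` rounds this covers at most half the way from `0`.
  have hstep : ∀ t, t < 2 * p →
      2 * p * (σ * x (2 * p + t + 1) 0) ≤ 2 * p * (σ * x (2 * p + t) 0) + w 0 / 2 := by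
    intro t ht
    have hp : (0:ℝ) < 2 * p := by
      have : 0 < p := by omega
      positivity
    have h2 := hdisp (2 * p + t)
    rw [hcq t ht] at h2
    set S := ε + ∑ s ∈ Finset.range (2 * p + t + 1), c s ^ 2 with hSdef
    have hSge : 2 * p * G ^ 2 ≤ S := by
      have : ∑ s ∈ Finset.range (2 * p), c s ^ 2 ≤ ∑ s ∈ Finset.range (2 * p + t + 1), c s ^ 2 :=
        Finset.sum_le_sum_of_subset_of_nonneg (Finset.range_mono (by omega))
          fun _ _ _ => sq_nonneg _
      linarith
    have hS0 : 0 < S := lt_of_lt_of_le (by positivity) hSge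
    set e := γ⁻¹ * (η / S) with he
    have he0 : 0 ≤ e := by positivity
    have he1 : 2 * p * e ≤ w 0 / 4 := by
      have : e = η / (γ * S) := by rw [he]; field_simp
      rw [this, mul_div_assoc', div_le_iff₀ (by positivity)]
      have h5 : γ * (2 * p * G ^ 2) ≤ γ * S := by gcongr
      have h6 := mul_le_mul_of_nonneg_left h5 (hw 0)
      have h7 := mul_le_mul_of_nonneg_left hηw hp.le
      linarith
    have h3 : γ⁻¹ * (-(σ * η) / S) = -(σ * e) := by rw [he]; ring
    rw [h3] at h2
    set Δ := x (2 * p + t + 1) 0 - x (2 * p + t) 0 with hΔ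
    have h4 : (σ * Δ) ^ 2 ≤ 2 * e * (σ * Δ) := by
      rw [mul_pow, hσ]; linarith
    have h5 : σ * Δ ≤ 2 * e := by
      by_contra! h
      nlinarith
    have h6 : σ * x (2 * p + t + 1) 0 = σ * x (2 * p + t) 0 + σ * Δ := by rw [hΔ]; ring
    rw [h6]
    nlinarith
  have hpos : ∀ t, t < 2 * p → 2 * p * (σ * x (2 * p + t) 0) ≤ t * (w 0 / 2) := by
    intro t
    induction t with
    | zero =>
      intro _
      have := mul_nonpos_of_nonneg_of_nonpos (by positivity : (0:ℝ) ≤ 2 * p) hq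
      simpa using this
    | succ t ih =>
      intro ht
      have h2 := ih (by omega)
      have h3 := hstep t (by omega)
      push_cast
      rw [← add_assoc]
      linarith
  have h2 : 2 * p * (η * (w 0 / 2)) ≤ ∑ t ∈ Finset.range (2 * p),
      (linearLoss c (2 * p + t) (x (2 * p + t)) - linearLoss c (2 * p + t) u) := by
    have : ∑ _t ∈ Finset.range (2 * p), η * (w 0 / 2) = 2 * p * (η * (w 0 / 2)) := by simp
    rw [← this]
    refine Finset.sum_le_sum fun t ht => ?_
    have ht := Finset.mem_range.1 ht
    have htp : (t : ℝ) ≤ 2 * p := by exact_mod_cast ht.le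
    have hp : (0:ℝ) < 2 * p := by
      have : 0 < p := by omega
      positivity
    have h3 : σ * x (2 * p + t) 0 ≤ w 0 / 2 := by
      refine le_of_mul_le_mul_left ((hpos t ht).trans ?_) hp
      exact mul_le_mul_of_nonneg_right htp (by linarith [hw 0])
    simp only [linearLoss, hcq t ht, hu0]
    have h4 : -(σ * η) * x (2 * p + t) 0 - -(σ * η) * (σ * w 0) =
        η * (σ ^ 2 * w 0 - σ * x (2 * p + t) 0) := by ring
    rw [h4, hσ]
    exact mul_le_mul_of_nonneg_left (by linarith) hη
  linarith

theorem exists_linear_regret {d : ℕ} [NeZero d] {w : Fin d → ℝ} {γ ε G η : ℝ}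
    (hw : ∀ i, 0 ≤ w i) (hγ : 0 < γ) (hε : 0 < ε) (hG : 0 < G) (hη : 0 ≤ η) (hηG : η ≤ G)
    (hηw : η ≤ γ * G ^ 2 * w 0 / 4) {x₁ : EuclideanSpace ℝ (Fin d)} (hx₁ : x₁ ∈ box w)
    {p T : ℕ} (hT : 4 * p ≤ T) :
    ∃ f : ℕ → EuclideanSpace ℝ (Fin d) → ℝ, IsLossSequence G (box w) T f ∧
      (∀ t, 4 * p ≤ t → f t = 0) ∧
      2 * p * (η * (w 0 / 2)) ≤ regret (box w) T f (ons (box w) γ ε x₁ f) := by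
  obtain ⟨σ, hσ, hq⟩ : ∃ σ : ℝ, σ ^ 2 = 1 ∧
      σ * ons (box w) γ ε x₁ (linearLoss (slopes G (σ * η) (2 * p))) (2 * p) 0 ≤ 0 := by
    -- The first `2 p` losses do not involve `σ`, so the sign can be chosen after seeing the point
    -- of round `2 p`.
    have hcongr : ons (box w) γ ε x₁ (linearLoss (slopes G (-1 * η) (2 * p))) (2 * p) =
        ons (box w) γ ε x₁ (linearLoss (slopes G (1 * η) (2 * p))) (2 * p) := by
      unfold ons
      rw [onsState_congr (box w) γ ε x₁ fun s hs => ?_]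
      funext y
      simp [linearLoss, slopes, hs]
    rcases le_total (ons (box w) γ ε x₁ (linearLoss (slopes G (1 * η) (2 * p))) (2 * p) 0) 0
      with h | h
    · exact ⟨1, by norm_num, by rw [one_mul (ons _ _ _ _ _ _ _)]; exact h⟩
    · exact ⟨-1, by norm_num, by rw [hcongr]; linarith⟩
  refine ⟨linearLoss (slopes G (σ * η) (2 * p)), isLossSequence_linearLoss
    (abs_slopes_le hG.le ?_ _) (convex_box w) T, fun t ht => ?_,
    linear_regret hw hγ hε hG hη hηG hηw hσ hx₁ (by omega) hq⟩
  · have hσ1 : |σ| = 1 := by rw [← sq_eq_sq₀ (abs_nonneg _) zero_le_one, sq_abs, hσ, one_pow]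
    rw [abs_mul, hσ1, one_mul, abs_of_nonneg hη]
    exact hηG
  · funext y
    have : slopes G (σ * η) (2 * p) t = 0 := by
      rw [slopes, if_neg (by omega), if_neg (by omega)]
    simp [linearLoss, this]

/-! ### Choice of constants and combination of the two bounds. -/

theorem half_log_le_sum_inv {s : ℝ} (hs : 0 ≤ s) {d T : ℕ} (hd : 1 ≤ d)
    (hT : ((d : ℝ) * (s + 1)) ^ 2 ≤ T) :
    Real.log T / 2 ≤ ∑ n ∈ Finset.range (T / d), 1 / (s + n + 1) := by
  have hd0 : (0:ℝ) < d := by exact_mod_cast hd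
  have hT0 : (0:ℝ) < T := lt_of_lt_of_le (by positivity) hT
  refine le_trans ?_ (log_le_sum_inv hs (T / d))
  have h1 : (T : ℝ) / d ≤ s + (T / d : ℕ) + 1 := by
    have : (T : ℝ) ≤ d * ((T / d : ℕ) + 1) := by
      exact_mod_cast (Nat.lt_mul_div_succ T hd).le
    have := (div_le_iff₀' hd0).2 this
    linarith
  have h2 := Real.log_le_log (by positivity) h1
  have h3 := Real.log_le_log (by positivity) hT
  rw [Real.log_pow, Real.log_mul (by positivity) (by positivity)] at h3
  rw [Real.log_div (by positivity) (by positivity)] at h2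
  push_cast at h3
  linarith

theorem isContaminated_range {d : ℕ} {F : Set (EuclideanSpace ℝ (Fin d) → ℝ)} {T k : ℕ}
    {f : ℕ → EuclideanSpace ℝ (Fin d) → ℝ} (hk : k ≤ T) (hf : ∀ t, k ≤ t → f t ∈ F) :
    IsContaminated F T k f :=
  ⟨Finset.range k, Finset.range_mono hk, Finset.card_range k, fun t ht => hf t (by
    simpa using (Finset.mem_sdiff.1 ht).2)⟩

end ContaminatedOCO

open ContaminatedOCO

theorem mainTheorem11 :
    ∃ c₁ : ℝ, 0 < c₁ ∧
      ∀ G D γ : ℝ, 0 < G → 0 < D → 0 < γ →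
        ∃ c₂ : ℝ, 0 < c₂ ∧
          ∀ (d : ℕ) (α ε : ℝ), 1 ≤ d → 0 < α → 0 < ε →
            ∃ X : Set (EuclideanSpace ℝ (Fin d)), ContaminatedOCO.IsDecisionSet D X ∧
              ∃ T₀ : ℕ, ∀ T k : ℕ, T₀ ≤ T → k ≤ T →
                ∀ x₁ ∈ X, ∃ f : ℕ → EuclideanSpace ℝ (Fin d) → ℝ,
                  ContaminatedOCO.IsLossSequence G X T f ∧
                  ContaminatedOCO.IsContaminated
                    {h | ContaminatedOCO.IsExpConcave X α h} T k f ∧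
                  c₁ * ((d : ℝ) / α * Real.log T) + c₂ * (k : ℝ) ≤
                    ContaminatedOCO.regret X T f (ContaminatedOCO.ons X γ ε x₁ f) := by
  refine ⟨1 / 64, by norm_num, fun G D γ hG hD hγ => ?_⟩
  set η := min G (γ * G ^ 2 * (D / 4) / 4) with hη
  have hη0 : 0 < η := lt_min hG (by positivity)
  refine ⟨η * D / 64, by positivity, fun d α ε hd hα hε => ?_⟩
  have : NeZero d := ⟨by omega⟩
  have hd1 : (1:ℝ) ≤ d := by exact_mod_cast hd
  have hd0 : (0:ℝ) < d := by linarith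
  set ρ := D / (8 * d) with hρ
  have hρ0 : 0 < ρ := by positivity
  have hρD : ρ ≤ D / 8 := by
    rw [hρ]; exact div_le_div_of_nonneg_left hD.le (by norm_num) (by linarith)
  -- The first summand keeps all distances to the centres at most `2 b`; the second makes the
  -- gradient bound `l * (2 b) = 1 / (2 α b)` at most `G`.
  set b := D / 2 + 1 / (2 * α * G) with hb
  have hbD : D / 2 < b := by
    have : 0 < 1 / (2 * α * G) := by positivity
    linarith
  have hb0 : 0 < b := by linarith
  have hbG : 1 ≤ 2 * α * G * b := by
    have : 2 * α * G * b = α * G * D + 1 := by rw [hb]; field_simp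
    rw [this]
    have : 0 < α * G * D := by positivity
    linarith
  -- The curvature with `α l (2 b)² = 1`, the limit of exp-concavity at distance `2 b`.
  set l := 1 / (4 * α * b ^ 2) with hl
  have hl0 : 0 < l := by positivity
  set s := 2 * b ^ 2 / ρ ^ 2 with hs
  have hs0 : 0 < s := by positivity
  -- Coordinate `0` has a width independent of `d`, so that `c₂` is too; the others shrink like
  -- `1/d` to keep the diameter at most `D`.
  let w : Fin d → ℝ := fun i => if i = 0 then D / 4 else D / (4 * d)
  have hD4 : D / (4 * d) ≤ D / 4 :=
    div_le_div_of_nonneg_left hD.le (by norm_num) (by linarith)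
  have hD4ρ : D / (4 * d) = 2 * ρ := by rw [hρ]; field_simp; norm_num
  have hwR : ∀ i, w i ≤ D / 4 := fun i => by simp only [w]; split_ifs <;> linarith
  have hwρ : ∀ i, 2 * ρ ≤ w i := fun i => by simp only [w]; split_ifs <;> linarith
  have hw0 : w 0 = D / 4 := if_pos rfl
  have hw : ∀ i, 0 ≤ w i := fun i => by linarith [hwρ i]
  have hX : IsDecisionSet D (box w) := by
    refine isDecisionSet_box hw ?_
    calc ∑ i, 2 * w i ≤ ∑ i : Fin d, ((if i = 0 then D / 2 else 0) + D / (2 * d)) := by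
          refine Finset.sum_le_sum fun i _ => ?_
          have h1 : D / (2 * d) = 2 * (D / (4 * d)) := by field_simp; norm_num
          have h2 : 0 < D / (4 * d) := by positivity
          simp only [w]
          split_ifs <;> linarith
      _ = D := by
          rw [Finset.sum_add_distrib]
          simp
          field_simp
          norm_num
  have hRb : D / 4 + ρ + b ≤ 2 * b := by linarith
  have hαl : α * l * (D / 4 + ρ + b) ^ 2 ≤ 1 := by
    calc α * l * (D / 4 + ρ + b) ^ 2 ≤ α * l * (2 * b) ^ 2 := by gcongr
      _ = 1 := by rw [hl]; field_simp; norm_num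
  have hlG : l * (D / 4 + ρ + b) ≤ G := by
    calc l * (D / 4 + ρ + b) ≤ l * (2 * b) := by gcongr
      _ = 1 / (2 * α * b) := by rw [hl]; field_simp; norm_num
      _ ≤ G := by rw [div_le_iff₀ (by positivity)]; linarith
  have hbs2 : 2 * b ^ 2 ≤ s * ρ ^ 2 := by rw [hs]; field_simp; rfl
  have hbs : b ≤ s * ρ := by
    refine le_of_mul_le_mul_right ?_ hρ0
    nlinarith
  -- For `log T ≥ L` the logarithmic target is at least `4 c₂`; so if the target `c₂ k` dominates,
  -- `k ≥ 4` and `k / 4` rounds down to at least `k / 8`.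
  set L := 4 * (η * D / 64) / (1 / 64 * (d / α)) with hL
  refine ⟨box w, hX, ⌈((d : ℝ) * (s + 1)) ^ 2⌉₊ + ⌈Real.exp L⌉₊, fun T k hT hkT x₁ hx₁ => ?_⟩
  have hT1 : ((d : ℝ) * (s + 1)) ^ 2 ≤ T :=
    (Nat.le_ceil _).trans (by exact_mod_cast (Nat.le_add_right _ _).trans hT)
  have hT2 : Real.exp L ≤ T :=
    (Nat.le_ceil _).trans (by exact_mod_cast (Nat.le_add_left _ _).trans hT)
  have hT0 : (0:ℝ) < T := lt_of_lt_of_le (Real.exp_pos _) hT2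
  have hlogL : L ≤ Real.log T := (Real.le_log_iff_exp_le hT0).2 hT2
  have hlog := half_log_le_sum_inv hs0.le hd hT1
  rcases le_total (η * D / 64 * k) (1 / 64 * (d / α * Real.log T)) with hk | hk
  · have hTd : d ≤ T := by
      have : (d : ℝ) ≤ (d * (s + 1)) ^ 2 := by nlinarith [mul_pos hd0 hs0]
      exact_mod_cast this.trans hT1
    obtain ⟨f, hf, hreg⟩ := exists_log_regret (T := T) (N := T / d) γ ε hα.le hG.le hb0 hl0.le hs0
      hρ0 hbs hbs2 hαl hlG hwR hwρ (Nat.div_pos hTd hd) (Nat.mul_div_le T d) x₁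
    refine ⟨f, ⟨fun t _ => (hf t).convexOn, fun t _ => (hf t).differentiableAt,
      fun t _ => (hf t).norm_gradient_le⟩, isContaminated_range hkT fun t _ =>
      (hf t).isExpConcave, le_trans ?_ hreg⟩
    have h1 : ∀ H : ℝ, d * (l / 2 * (b ^ 2 / 2 * H)) = d / (16 * α) * H := fun H => by
      rw [hl]; field_simp; ring
    rw [h1]
    have h2 : (d : ℝ) / (16 * α) * (Real.log T / 2) = 2 * (1 / 64 * (d / α * Real.log T)) := by
      field_simp; ring
    have h3 := mul_le_mul_of_nonneg_left hlog (by positivity : (0:ℝ) ≤ d / (16 * α))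
    linarith
  · obtain ⟨f, hf, hf0, hreg⟩ := exists_linear_regret (p := k / 4) (T := T) hw hγ hε hG hη0.le
      (min_le_left _ _) (by rw [hw0]; exact min_le_right _ _) hx₁ (by omega)
    refine ⟨f, hf, isContaminated_range hkT fun t ht => ?_, le_trans ?_ hreg⟩
    · rw [hf0 t (by omega)]
      exact (isExpConcaveLoss_zero hG.le α hX.convex).isExpConcave
    · have hk4 : 4 ≤ k := by
        have h1 : η * D / 64 * 4 ≤ η * D / 64 * k := by
          refine le_trans ?_ hk
          have h2 := mul_le_mul_of_nonneg_left hlogL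
            (by positivity : (0:ℝ) ≤ 1 / 64 * (d / α))
          have h3 : 1 / 64 * (d / α) * L = 4 * (η * D / 64) := by
            rw [hL]; exact mul_div_cancel₀ _ (by positivity)
          linarith
        exact_mod_cast le_of_mul_le_mul_left h1 (by positivity)
      have hk8 : (k : ℝ) ≤ 8 * (k / 4 : ℕ) := by
        have : k ≤ 8 * (k / 4) := by omega
        exact_mod_cast this
      rw [hw0]
      have := mul_le_mul_of_nonneg_left hk8 (by positivity : (0:ℝ) ≤ η * D)
      linarith
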